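/- Let $(M,J)$ be a connected closed complex manifold of real dimension $2n+2$, $n\ge 1$, with a Hermitian metric $g$, Levi-Civita connection $\nabla$ and fundamental form $\omega(X,Y)=g(X,JY)$. Let $\theta$ be a $1$-form with $\nabla\theta=0$, $d\omega=\theta\wedge\omega$ and $\|\theta\|=1$; that is, $(M,J,g)$ is a Vaisman manifold with Lee form $\theta$ of norm $1$. Let $U$ be the vector field dual to $\theta$ and let $\operatorname{Ric}^D$ be the Ricci tensor of the Weyl connection $$D_XY=\nabla_XY-\tfrac12\bigl(\theta(X)Y+\theta(Y)X-g(X,Y)U\bigr).$$ Let $p:\tilde M\to M$ be the universal covering, let $f\in C^\infty(\tilde M)$ be a function with $df=p^*\theta$, and let $\tilde g=e^{-f}p^*g$. Call $(g,\theta)$ an *Einstein-Weyl structure* if $p^*\operatorname{Ric}^D=\lambda\tilde g$ for some constant $\lambda\in\mathbb R$, and call $g$ *quasi-Einstein* if $\operatorname{Ric}=\lambda g+\beta\,\theta\otimes\theta$ for some $\lambda,\beta\in C^\infty(M)$, where $\operatorname{Ric}$ is the Ricci tensor of $g$. Then $(g,\theta)$ is an Einstein-Weyl structure if and only if $g$ is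 quasi-Einstein. -/

import Mathlib

open Bundle FiberBundle VectorField Module
open scoped Manifold ContDiff

noncomputable section

namespace VaismanGeometry

variable {E : Type*} [NormedAddCommGroup E] [NormedSpace ℝ E] [FiniteDimensional ℝ E]
  {H : Type*} [TopologicalSpace H] {I : ModelWithCorners ℝ E H}
  {M : Type*} [TopologicalSpace M] [ChartedSpace H M] [IsManifold I ∞ M]

instance finiteDimensional_tangentSpace (x : M) : FiniteDimensional ℝ (TangentSpace I x) :=
  inferInstanceAs (FiniteDimensional ℝ E)

/-- The curvature `R(X, Y) Z = ∇_X ∇_Y Z - ∇_Y ∇_X Z - ∇_[X, Y] Z` of an affine connection.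
(In Mathlib `cov Z x (X x)` is the value of `∇_X Z` at `x`.) -/
def curvature (cov : CovariantDerivative I E (TangentSpace I : M → Type _))
    (X Y Z : Π x : M, TangentSpace I x) (x : M) : TangentSpace I x :=
  cov (fun y => cov Z y (Y y)) x (X x) - cov (fun y => cov Z y (X y)) x (Y x)
    - cov Z x (mlieBracket I X Y x)

/-- The Ricci tensor of an affine connection: `Ric(v, w)` is the trace of `u ↦ R(u, v) w` on the
tangent space at `x`. The curvature tensor is evaluated on vector fields that extend the given
tangent vectors smoothly near `x`, and the trace is computed in a basis. -/
def ricci (cov : CovariantDerivative I E (TangentSpace I : M → Type _)) (x : M)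
    (v w : TangentSpace I x) : ℝ :=
  ∑ i, (finBasis ℝ (TangentSpace I x)).repr
    (curvature cov (extend E (finBasis ℝ (TangentSpace I x) i)) (extend E v) (extend E w) x) i

/-- The data `J` is an integrable almost complex structure: a smooth field of endomorphisms of
the tangent spaces with `J² = -1` and vanishing Nijenhuis tensor. -/
structure IsComplexStructure (J : Π x : M, TangentSpace I x →L[ℝ] TangentSpace I x) : Prop where
  contMDiff : ContMDiff I (I.prod 𝓘(ℝ, E →L[ℝ] E)) ∞
    (fun x => TotalSpace.mk' (E →L[ℝ] E) (E := fun x : M => TangentSpace I x →L[ℝ] TangentSpace I x)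
      x (J x))
  sq : ∀ (x : M) (v : TangentSpace I x), J x (J x v) = -v
  integrable : ∀ (x : M) (X Y : Π x : M, TangentSpace I x),
    MDifferentiableAt I I.tangent (fun y => (X y : TangentBundle I M)) x →
    MDifferentiableAt I I.tangent (fun y => (Y y : TangentBundle I M)) x →
    mlieBracket I (fun y => J y (X y)) (fun y => J y (Y y)) x
      - J x (mlieBracket I (fun y => J y (X y)) Y x)
      - J x (mlieBracket I X (fun y => J y (Y y)) x)
      - mlieBracket I X Y x = 0

/-- The exterior derivative of a 2-form, evaluated on three vector fields. -/
def extDerivTwoForm (α : Π x : M, TangentSpace I x → TangentSpace I x → ℝ)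
    (X Y Z : Π x : M, TangentSpace I x) (x : M) : ℝ :=
  mvfderiv I (fun y => α y (Y y) (Z y)) x (X x)
    + mvfderiv I (fun y => α y (Z y) (X y)) x (Y x)
    + mvfderiv I (fun y => α y (X y) (Y y)) x (Z x)
    - α x (mlieBracket I X Y x) (Z x)
    - α x (mlieBracket I Y Z x) (X x)
    - α x (mlieBracket I Z X x) (Y x)

variable [RiemannianBundle (fun x : M => TangentSpace I x)]

/-- The right-hand side of the Koszul formula for `g(∇_X Y, Z)`. -/
def koszul (X Y Z : Π x : M, TangentSpace I x) (x : M) : ℝ :=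
  (1 / 2) *
    (mvfderiv I (fun y => inner ℝ (Y y) (Z y)) x (X x)
      + mvfderiv I (fun y => inner ℝ (Z y) (X y)) x (Y x)
      - mvfderiv I (fun y => inner ℝ (X y) (Y y)) x (Z x)
      + inner ℝ (mlieBracket I X Y x) (Z x)
      - inner ℝ (mlieBracket I Y Z x) (X x)
      + inner ℝ (mlieBracket I Z X x) (Y x))

/-- An orthonormal basis of the tangent space at `x`, extended to vector fields that are smooth
near `x`. -/
def frame (x : M) (i : Fin (finrank ℝ (TangentSpace I x))) : Π y : M, TangentSpace I y :=
  extend E (stdOrthonormalBasis ℝ (TangentSpace I x) i)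

/-- The Levi-Civita connection on vector fields, `∇_v Y = ∑ᵢⱼ g(v, eᵢ) g(∇_{eᵢ} Y, eⱼ) eⱼ`
with `g(∇_{eᵢ} Y, eⱼ)` given by the Koszul formula. -/
def leviCivitaFun (Y : Π x : M, TangentSpace I x) (x : M) :
    TangentSpace I x →L[ℝ] TangentSpace I x :=
  ∑ i, ∑ j, koszul (frame x i) Y (frame x j) x •
    (innerSL ℝ (frame (I := I) x i x)).smulRight (frame (I := I) x j x)

theorem mdifferentiableAt_frame (x : M) (i : Fin (finrank ℝ (TangentSpace I x))) :
    MDifferentiableAt I I.tangent (fun y => (frame x i y : TangentBundle I M)) x :=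
  mdifferentiableAt_extend I E _

section

variable [IsContMDiffRiemannianBundle I ∞ E (fun x : M => TangentSpace I x)]

theorem mdifferentiableAt_inner {X Y : Π x : M, TangentSpace I x} {x : M}
    (hX : MDifferentiableAt I I.tangent (fun y => (X y : TangentBundle I M)) x)
    (hY : MDifferentiableAt I I.tangent (fun y => (Y y : TangentBundle I M)) x) :
    MDifferentiableAt I 𝓘(ℝ, ℝ) (fun y => inner ℝ (X y) (Y y)) x :=
  MDifferentiableAt.inner_bundle (F := E) (E := fun x : M => TangentSpace I x) (IB := I)
    (b := fun y => y) (v := X) (w := Y) hX hY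

theorem koszul_add {X Y Y' Z : Π x : M, TangentSpace I x} {x : M}
    (hX : MDifferentiableAt I I.tangent (fun y => (X y : TangentBundle I M)) x)
    (hY : MDifferentiableAt I I.tangent (fun y => (Y y : TangentBundle I M)) x)
    (hY' : MDifferentiableAt I I.tangent (fun y => (Y' y : TangentBundle I M)) x)
    (hZ : MDifferentiableAt I I.tangent (fun y => (Z y : TangentBundle I M)) x) :
    koszul X (Y + Y') Z x = koszul X Y Z x + koszul X Y' Z x := by
  have h1 := mdifferentiableAt_inner hY hZ
  have h2 := mdifferentiableAt_inner hY' hZ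
  have h3 := mdifferentiableAt_inner hX hY
  have h4 := mdifferentiableAt_inner hX hY'
  simp only [koszul, Pi.add_apply, inner_add_left, inner_add_right]
  rw [mvfderiv_fun_add h1 h2, mvfderiv_fun_add h3 h4,
    mlieBracket_add_right hY hY', mlieBracket_add_left hY hY']
  simp only [inner_add_left, map_add, add_apply]
  ring

theorem koszul_smul {X Y Z : Π x : M, TangentSpace I x} {f : M → ℝ} {x : M}
    (hX : MDifferentiableAt I I.tangent (fun y => (X y : TangentBundle I M)) x)
    (hY : MDifferentiableAt I I.tangent (fun y => (Y y : TangentBundle I M)) x)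
    (hZ : MDifferentiableAt I I.tangent (fun y => (Z y : TangentBundle I M)) x)
    (hf : MDifferentiableAt I 𝓘(ℝ, ℝ) f x) :
    koszul X (f • Y) Z x
      = f x * koszul X Y Z x + mvfderiv I f x (X x) * inner ℝ (Y x) (Z x) := by
  simp only [koszul, Pi.smul_apply', inner_smul_left, inner_smul_right, RCLike.conj_to_real]
  rw [mvfderiv_fun_mul hf (mdifferentiableAt_inner hY hZ), mvfderiv_fun_mul hf (mdifferentiableAt_inner hX hY),
    mlieBracket_smul_right hf hY, mlieBracket_smul_left hf hY]
  simp [inner_add_left, inner_smul_left]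
  rw [real_inner_comm (Y x) (X x)]
  ring

variable (I M) in
/-- The Levi-Civita connection of a Riemannian manifold. -/
def leviCivita : CovariantDerivative I E (TangentSpace I : M → Type _) where
  toFun := leviCivitaFun
  isCovariantDerivativeOnUniv :=
    { add := by
        intro Y Y' x hY hY' _
        simp only [leviCivitaFun]
        simp only [koszul_add (mdifferentiableAt_frame x _) hY hY' (mdifferentiableAt_frame x _),
          add_smul, Finset.sum_add_distrib]
      leibniz := by
        intro Y f x hY hf _
        ext v
        have h : ∀ i j, koszul (frame x i) (f • Y) (frame x j) x = _ := fun i j =>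
          koszul_smul (mdifferentiableAt_frame x i) hY (mdifferentiableAt_frame x j) hf
        have hv := (stdOrthonormalBasis ℝ (TangentSpace I x)).sum_repr' v
        have hYx := (stdOrthonormalBasis ℝ (TangentSpace I x)).sum_repr' (Y x)
        have hd : mvfderiv I f x v = ∑ i, inner ℝ (frame (I := I) x i x) v
            * mvfderiv I f x (frame (I := I) x i x) := by
          conv_lhs => rw [← hv]
          simp [frame]
        have hR : ((mvfderiv I f x).smulRight (Y x)) v = ∑ i, ∑ j,
            (mvfderiv I f x (frame (I := I) x i x) * inner ℝ (Y x) (frame (I := I) x j x))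
              • inner ℝ (frame (I := I) x i x) v • frame (I := I) x j x := by
          rw [ContinuousLinearMap.smulRight_apply, hd, Finset.sum_smul]
          refine Finset.sum_congr rfl fun i _ => ?_
          conv_lhs => rw [← hYx, Finset.smul_sum]
          refine Finset.sum_congr rfl fun j _ => ?_
          simp only [frame, extend_apply_self, smul_smul]
          rw [real_inner_comm (Y x) _]
          congr 1
          ring
        rw [add_apply, hR]
        simp only [leviCivitaFun, h, add_smul, Finset.sum_add_distrib, sum_apply, add_apply,
          smul_apply, ContinuousLinearMap.smulRight_apply, innerSL_apply_apply, mul_smul,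
          Finset.smul_sum] }

/-- The vector field `U` dual to a 1-form `θ` with respect to the metric. -/
def sharp (θ : Π x : M, TangentSpace I x →L[ℝ] ℝ) (x : M) : TangentSpace I x :=
  (InnerProductSpace.toDual ℝ (TangentSpace I x)).symm (θ x)

/-- The Weyl connection `D_X Y = ∇_X Y - (θ(X) Y + θ(Y) X - g(X, Y) U) / 2`, where `∇` is the
Levi-Civita connection and `U` is dual to `θ`. -/
def weylConnection (θ : Π x : M, TangentSpace I x →L[ℝ] ℝ) :
    CovariantDerivative I E (TangentSpace I : M → Type _) where
  toFun Y x := leviCivita I M Y x - (1 / 2 : ℝ) •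
    ((θ x).smulRight (Y x) + θ x (Y x) • ContinuousLinearMap.id ℝ (TangentSpace I x)
      - (innerSL ℝ (Y x)).smulRight (sharp θ x))
  isCovariantDerivativeOnUniv :=
    { add := by
        intro Y Y' x hY hY' _
        rw [(leviCivita I M).isCovariantDerivativeOnUniv.add hY hY']
        ext v
        simp
        module
      leibniz := by
        intro Y f x hY hf _
        rw [(leviCivita I M).isCovariantDerivativeOnUniv.leibniz hY hf]
        ext v
        simp
        module }

/-- `θ` is parallel for the Levi-Civita connection: `v(θ(Y)) = θ(∇_v Y)` for every tangent vector
`v` at `x` and every vector field `Y` differentiable at `x`. -/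
def IsParallelOneForm (θ : Π x : M, TangentSpace I x →L[ℝ] ℝ) : Prop :=
  ∀ (x : M) (v : TangentSpace I x) (Y : Π x : M, TangentSpace I x),
    MDifferentiableAt I I.tangent (fun y => (Y y : TangentBundle I M)) x →
    mvfderiv I (fun y => θ y (Y y)) x v = θ x (leviCivita I M Y x v)

/-- The fundamental 2-form `ω(X, Y) = g(X, JY)`. -/
def fundamentalForm (J : Π x : M, TangentSpace I x →L[ℝ] TangentSpace I x) (x : M)
    (v w : TangentSpace I x) : ℝ :=
  inner ℝ v (J x w)

/-- `(J, g, θ)` is a Vaisman structure with Lee form `θ`, where `g` is the ambient metric: `J` is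
a complex structure, `g` is Hermitian, `θ` is a smooth parallel 1-form, and `dω = θ ∧ ω`. -/
structure IsVaisman (J : Π x : M, TangentSpace I x →L[ℝ] TangentSpace I x)
    (θ : Π x : M, TangentSpace I x →L[ℝ] ℝ) : Prop where
  isComplexStructure : IsComplexStructure J
  hermitian : ∀ (x : M) (v w : TangentSpace I x), inner ℝ (J x v) (J x w) = inner ℝ v w
  contMDiff_lee : ContMDiff I (I.prod 𝓘(ℝ, E →L[ℝ] ℝ)) ∞
    (fun x => TotalSpace.mk' (E →L[ℝ] ℝ) (E := fun x : M => TangentSpace I x →L[ℝ] ℝ) x (θ x))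
  parallel : IsParallelOneForm θ
  extDeriv_eq : ∀ (x : M) (X Y Z : Π x : M, TangentSpace I x),
    MDifferentiableAt I I.tangent (fun y => (X y : TangentBundle I M)) x →
    MDifferentiableAt I I.tangent (fun y => (Y y : TangentBundle I M)) x →
    MDifferentiableAt I I.tangent (fun y => (Z y : TangentBundle I M)) x →
    extDerivTwoForm (fundamentalForm J) X Y Z x =
      θ x (X x) * fundamentalForm J x (Y x) (Z x)
        + θ x (Y x) * fundamentalForm J x (Z x) (X x)
        + θ x (Z x) * fundamentalForm J x (X x) (Y x)

/-- The metric is quasi-Einstein with respect to `θ`: `Ric = λ g + β θ ⊗ θ` for some smooth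
functions `λ` and `β`. -/
def IsQuasiEinstein (θ : Π x : M, TangentSpace I x →L[ℝ] ℝ) : Prop :=
  ∃ l β : M → ℝ, ContMDiff I 𝓘(ℝ, ℝ) ∞ l ∧ ContMDiff I 𝓘(ℝ, ℝ) ∞ β ∧
    ∀ (x : M) (v w : TangentSpace I x),
      ricci (leviCivita I M) x v w = l x * inner ℝ v w + β x * (θ x v * θ x w)

section Cover

variable {N : Type*} [TopologicalSpace N] [ChartedSpace H N]

variable (I) in
/-- `p : N → M` is a smooth universal covering. -/
structure IsUniversalCover (p : N → M) : Prop where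
  simplyConnected : SimplyConnectedSpace N
  surjective : Function.Surjective p
  isCoveringMap : IsCoveringMap p
  isLocalDiffeomorph : IsLocalDiffeomorph I I ∞ p

/-- `f` is a smooth function on `N` with `df = p^* θ`. -/
structure IsPrimitive (p : N → M) (θ : Π x : M, TangentSpace I x →L[ℝ] ℝ) (f : N → ℝ) : Prop where
  contMDiff : ContMDiff I 𝓘(ℝ, ℝ) ∞ f
  mvfderiv_eq : ∀ (y : N) (v : TangentSpace I y), mvfderiv I f y v = θ (p y) (mfderiv I I p y v)

variable (I) in
/-- The metric `e^{-f} p^* g` on `N`. -/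
def coverMetric (p : N → M) (f : N → ℝ) (y : N) (v w : TangentSpace I y) : ℝ :=
  Real.exp (-f y) *
    inner ℝ (mfderiv I I p y v : TangentSpace I (p y)) (mfderiv I I p y w : TangentSpace I (p y))

/-- `(g, θ)` is an Einstein-Weyl structure: on the universal covering `p : N → M`, with the metric
`g̃ = e^{-f} p^* g`, the Ricci tensor of the Weyl connection satisfies `Ric^D = λ g̃` for a
constant `λ`. -/
def IsEinsteinWeyl (p : N → M) (f : N → ℝ) (θ : Π x : M, TangentSpace I x →L[ℝ] ℝ) : Prop :=
  ∃ l : ℝ, ∀ (y : N) (v w : TangentSpace I y),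
    ricci (weylConnection θ) (p y) (mfderiv I I p y v) (mfderiv I I p y w)
      = l * coverMetric I p f y v w

end Cover

end

end VaismanGeometry

end

open Bundle FiberBundle VectorField Module Filter
open scoped Manifold ContDiff Topology

set_option linter.unusedSectionVars false

noncomputable section

namespace VaismanGeometry

variable {E : Type*} [NormedAddCommGroup E] [NormedSpace ℝ E] [FiniteDimensional ℝ E]
  {H : Type*} [TopologicalSpace H] {I : ModelWithCorners ℝ E H}
  {M : Type*} [TopologicalSpace M] [ChartedSpace H M] [IsManifold I ∞ M]

/-! Both conditions are equivalent to Ric^D = 0. Let d be the real dimension and T(v, w) = θ(v)w +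
θ(w)v - g(v, w)U, so that D = ∇ - T/2. Since θ is parallel, so are U and T; T is also symmetric and
∇ is torsion-free, so R^D - R is one quarter of the commutator of T. Taking the trace, with |θ| = 1,
gives Ric^D = Ric - (d-2)/4 (g - θ⊗θ) (`ricci_weylConnection`).

Einstein-Weyl: parallelism gives Ric(U, U) = 0 (`ricci_sharp_sharp`), and g - θ⊗θ vanishes on (U,
U), so Ric^D(U, U) = 0. As g̃ is positive definite, the Einstein constant must be 0.

Quasi-Einstein: Ric^D = 0 says Ric = (d-2)/4 (g - θ⊗θ). Conversely, if Ric = λg + βθ⊗θ, the values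
on U and on V = JU determine λ and β. This needs Ric(V, V) = (d-2)/4 (`IsVaisman.ricci_reeb`):
integrability of J and dω = θ∧ω determine ∇J and hence ∇V; V turns out to be Killing with geodesic
orbits, so Ric(V, V) is the sum of |∇_e V|² over an orthonormal basis.

The Ricci tensor is computed from local extensions of vectors, so the argument also rests on
tensoriality of the curvature (`curvature_congr`), which is deduced from its symmetries. -/

/-- The vector field `X` is smooth at the point `x`. -/
def IsSmoothAt (X : Π x : M, TangentSpace I x) (x : M) : Prop :=
  ContMDiffAt I I.tangent ∞ (fun y => (X y : TangentBundle I M)) x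

/-! ### Smooth vector fields, brackets and derivatives at a point -/

section Smooth

variable {X Y Z W : Π x : M, TangentSpace I x} {x : M} {f : M → ℝ}

theorem isSmoothAt_extend (v : TangentSpace I x) : IsSmoothAt (I := I) (extend E v) x :=
  contMDiffAt_extend I E v

theorem IsSmoothAt.mdifferentiableAt (hX : IsSmoothAt X x) :
    MDifferentiableAt I I.tangent (fun y => (X y : TangentBundle I M)) x :=
  ContMDiffAt.mdifferentiableAt hX (by simp)

theorem IsSmoothAt.eventually_mdifferentiableAt (hX : IsSmoothAt X x) :
    ∀ᶠ y in 𝓝 x, MDifferentiableAt I I.tangent (fun y => (X y : TangentBundle I M)) y := by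
  have h1 : ContMDiffAt I I.tangent 1 (fun y => (X y : TangentBundle I M)) x :=
    ContMDiffAt.of_le hX (by simp)
  filter_upwards [(contMDiffAt_iff_contMDiffAt_nhds (by simp)).1 h1] with y hy
  exact hy.mdifferentiableAt (by simp)

theorem eventually_mdifferentiableAt_of_contMDiffAt (hf : ContMDiffAt I 𝓘(ℝ, ℝ) ∞ f x) :
    ∀ᶠ y in 𝓝 x, MDifferentiableAt I 𝓘(ℝ, ℝ) f y := by
  have h1 : ContMDiffAt I 𝓘(ℝ, ℝ) 1 f x := hf.of_le (by simp)
  filter_upwards [(contMDiffAt_iff_contMDiffAt_nhds (by simp)).1 h1] with y hy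
  exact hy.mdifferentiableAt (by simp)

theorem IsSmoothAt.add (hX : IsSmoothAt X x) (hY : IsSmoothAt Y x) : IsSmoothAt (X + Y) x :=
  ContMDiffAt.add_section (V := fun x : M => TangentSpace I x) hX hY

theorem IsSmoothAt.sub (hX : IsSmoothAt X x) (hY : IsSmoothAt Y x) : IsSmoothAt (X - Y) x :=
  ContMDiffAt.sub_section (V := fun x : M => TangentSpace I x) hX hY

theorem IsSmoothAt.smul (hf : ContMDiffAt I 𝓘(ℝ, ℝ) ∞ f x) (hX : IsSmoothAt X x) :
    IsSmoothAt (f • X) x :=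
  ContMDiffAt.smul_section (V := fun x : M => TangentSpace I x) hf hX

theorem IsSmoothAt.const_smul (a : ℝ) (hX : IsSmoothAt X x) :
    IsSmoothAt (a • X) x :=
  ContMDiffAt.const_smul_section (V := fun x : M => TangentSpace I x) hX

theorem IsSmoothAt.mlieBracket (hX : IsSmoothAt X x) (hY : IsSmoothAt Y x) :
    IsSmoothAt (mlieBracket I X Y) x := by
  have : IsManifold I (((⊤ : ℕ∞) : ℕ∞ω) + 1) M := by
    simpa using (inferInstance : IsManifold I ∞ M)
  have : IsManifold I (minSmoothness ℝ 2) M := by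
    simp only [minSmoothness_of_isRCLikeNormedField]; infer_instance
  exact ContMDiffAt.mlieBracket_vectorField (m := ⊤) (n := ⊤) hX hY (by simp)

/-- The derivative of a smooth function along a smooth vector field is smooth. -/
theorem contMDiffAt_mvfderiv (hf : ContMDiffAt I 𝓘(ℝ, ℝ) ∞ f x) (hX : IsSmoothAt X x) :
    ContMDiffAt I 𝓘(ℝ, ℝ) ∞ (fun y => mvfderiv I f y (X y)) x := by
  have h1 := hf.mfderiv_const (m := ∞) (by simp)
  have h2 := ContMDiffAt.clm_apply_of_inCoordinates (F₁ := E) (E₁ := fun y : M => TangentSpace I y)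
    (F₂ := ℝ) (E₂ := fun y : ℝ => TangentSpace 𝓘(ℝ, ℝ) y) (b₁ := id) (b₂ := f) (v := X)
    (ϕ := fun y => mfderiv I 𝓘(ℝ, ℝ) f y) (n := ∞) (IB₁ := I) (IB₂ := 𝓘(ℝ, ℝ)) (IM := I)
    h1 hX hf
  rw [contMDiffAt_totalSpace] at h2
  have h3 := h2.2
  simp at h3
  exact h3

theorem mvfderiv_congr {f g : M → ℝ} (h : f =ᶠ[𝓝 x] g) (v : TangentSpace I x) :
    mvfderiv I f x v = mvfderiv I g x v := by
  have hfg : f x = g x := h.self_of_nhds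
  have h1 : ((mfderiv I 𝓘(ℝ, ℝ) f x : E →L[ℝ] ℝ)) = (mfderiv I 𝓘(ℝ, ℝ) g x : E →L[ℝ] ℝ) :=
    h.mfderiv_eq
  exact congrArg (fun L : E →L[ℝ] ℝ => L v) h1

/-- `X(Yf) - Y(Xf) = [X, Y]f`. -/
theorem mvfderiv_mvfderiv_sub (hf : ContMDiffAt I 𝓘(ℝ, ℝ) ∞ f x) (hX : IsSmoothAt X x)
    (hY : IsSmoothAt Y x) :
    mvfderiv I (fun y => mvfderiv I f y (Y y)) x (X x)
      - mvfderiv I (fun y => mvfderiv I f y (X y)) x (Y x)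
      = mvfderiv I f x (mlieBracket I X Y x) := by
  -- The argument needs a nonzero tangent vector at `x`; if both fields vanish there, so do both
  -- sides.
  by_cases hx : X x = 0 ∧ Y x = 0
  · have : mlieBracket I X Y x = 0 := by
      rw [← mlieBracketWithin_univ]
      exact mlieBracketWithin_eq_zero_of_eq_zero hx.1 hx.2
    simp [hx.1, hx.2, this]
  obtain ⟨v, hv⟩ : ∃ v : TangentSpace I x, v ≠ 0 := by
    by_cases h : X x = 0
    · exact ⟨Y x, fun h' => hx ⟨h, h'⟩⟩
    · exact ⟨_, h⟩
  set Z : Π x : M, TangentSpace I x := extend E v with hZ'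
  have hZ : IsSmoothAt Z x := isSmoothAt_extend v
  have hZx : Z x = v := by simp [hZ']
  -- Two applications of the product rule for the bracket: the second derivative of `f` appears as
  -- the coefficient of `Z`.
  have key : ∀ {A B : Π x : M, TangentSpace I x}, IsSmoothAt A x → IsSmoothAt B x →
      mlieBracket I A (mlieBracket I B (f • Z)) x
        = mvfderiv I (fun y => mvfderiv I f y (B y)) x (A x) • Z x
          + mvfderiv I f x (B x) • mlieBracket I A Z x
          + mvfderiv I f x (A x) • mlieBracket I B Z x
          + f x • mlieBracket I A (mlieBracket I B Z) x := by
    intro A B hA hB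
    have h1 : mlieBracket I B (f • Z) =ᶠ[𝓝 x]
        (fun y => mvfderiv I f y (B y)) • Z + f • mlieBracket I B Z := by
      filter_upwards [hZ.eventually_mdifferentiableAt,
        eventually_mdifferentiableAt_of_contMDiffAt hf] with y hZy hfy
      rw [mlieBracket_smul_right hfy hZy]
      rfl
    have hdf := contMDiffAt_mvfderiv hf hB
    rw [EventuallyEq.rfl.mlieBracket_vectorField_eq h1,
      mlieBracket_add_right (IsSmoothAt.smul hdf hZ).mdifferentiableAt
        (IsSmoothAt.smul hf (hB.mlieBracket hZ)).mdifferentiableAt,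
      mlieBracket_smul_right (hdf.mdifferentiableAt (by simp)) hZ.mdifferentiableAt,
      mlieBracket_smul_right (hf.mdifferentiableAt (by simp)) (hB.mlieBracket hZ).mdifferentiableAt]
    abel
  have hfZ : IsSmoothAt (f • Z) x := IsSmoothAt.smul hf hZ
  have : IsManifold I (minSmoothness ℝ 3) M := by
    simp only [minSmoothness_of_isRCLikeNormedField]; infer_instance
  have c2 : ∀ {A : Π x : M, TangentSpace I x}, IsSmoothAt A x →
      ContMDiffAt I I.tangent (minSmoothness ℝ 2) (fun y => (A y : TangentBundle I M)) x := by
    intro A hA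
    simp only [minSmoothness_of_isRCLikeNormedField]
    exact ContMDiffAt.of_le hA (ENat.LEInfty.out)
  -- Comparing the Jacobi identity for `f • Z` with `f` times the one for `Z` leaves the desired
  -- identity multiplied by `Z x = v ≠ 0`.
  have j1 := leibniz_identity_mlieBracket_apply (c2 hX) (c2 hY) (c2 hfZ)
  have j2 := leibniz_identity_mlieBracket_apply (c2 hX) (c2 hY) (c2 hZ)
  rw [key hX hY, key hY hX, mlieBracket_smul_right (hf.mdifferentiableAt (by simp))
    hZ.mdifferentiableAt, j2, hZx] at j1
  have h3 : (mvfderiv I (fun y => mvfderiv I f y (Y y)) x (X x)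
      - mvfderiv I (fun y => mvfderiv I f y (X y)) x (Y x)
      - mvfderiv I f x (mlieBracket I X Y x)) • v = 0 := by
    rw [sub_smul, sub_smul]
    rw [smul_add, ← sub_eq_zero] at j1
    rw [← j1]
    abel
  rcases smul_eq_zero.1 h3 with h | h
  · linarith
  · exact absurd h hv

end Smooth

/-! ### The Levi-Civita connection: Koszul formula, torsion, metricity, smoothness -/

section LeviCivita

variable [RiemannianBundle (fun x : M => TangentSpace I x)]
  [IsContMDiffRiemannianBundle I ∞ E (fun x : M => TangentSpace I x)]
  {X Y Z W : Π x : M, TangentSpace I x} {x : M}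

theorem IsSmoothAt.inner (hX : IsSmoothAt X x) (hY : IsSmoothAt Y x) :
    ContMDiffAt I 𝓘(ℝ, ℝ) ∞ (fun y => inner ℝ (X y) (Y y)) x :=
  ContMDiffAt.inner_bundle (F := E) (E := fun x : M => TangentSpace I x) (IB := I) (IM := I)
    (b := fun y => y) (v := X) (w := Y) hX hY

/-- The derivatives of `f` produced by the metric terms cancel those produced by the brackets.
Tensoriality in the outer slots is what lets the frame used to define ∇ be replaced by arbitrary
fields. -/
theorem koszul_tensorialAt_left
    (hY : MDifferentiableAt I I.tangent (fun y => (Y y : TangentBundle I M)) x)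
    (hZ : MDifferentiableAt I I.tangent (fun y => (Z y : TangentBundle I M)) x) :
    TensorialAt I E (fun X => koszul X Y Z x) x where
  smul := by
    intro f X hf hX
    simp only [koszul, Pi.smul_apply', inner_smul_left, inner_smul_right, RCLike.conj_to_real]
    rw [mvfderiv_fun_mul hf (mdifferentiableAt_inner hZ hX),
      mvfderiv_fun_mul hf (mdifferentiableAt_inner hX hY),
      mlieBracket_smul_right hf hX, mlieBracket_smul_left hf hX]
    simp [inner_add_left, inner_smul_left]
    rw [real_inner_comm (X x) (Z x)]
    ring
  add := by
    intro X X' hX hX'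
    simp only [koszul, Pi.add_apply, inner_add_left, inner_add_right]
    rw [mvfderiv_fun_add (mdifferentiableAt_inner hZ hX) (mdifferentiableAt_inner hZ hX'),
      mvfderiv_fun_add (mdifferentiableAt_inner hX hY) (mdifferentiableAt_inner hX' hY),
      mlieBracket_add_right hX hX', mlieBracket_add_left hX hX']
    simp only [inner_add_left, map_add, add_apply]
    ring

theorem koszul_tensorialAt_right
    (hX : MDifferentiableAt I I.tangent (fun y => (X y : TangentBundle I M)) x)
    (hY : MDifferentiableAt I I.tangent (fun y => (Y y : TangentBundle I M)) x) :
    TensorialAt I E (fun Z => koszul X Y Z x) x where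
  smul := by
    intro f Z hf hZ
    simp only [koszul, Pi.smul_apply', inner_smul_left, inner_smul_right, RCLike.conj_to_real]
    rw [mvfderiv_fun_mul hf (mdifferentiableAt_inner hY hZ),
      mvfderiv_fun_mul hf (mdifferentiableAt_inner hZ hX),
      mlieBracket_smul_right hf hZ, mlieBracket_smul_left hf hZ]
    simp [inner_add_left, inner_smul_left]
    rw [real_inner_comm (Z x) (Y x)]
    ring
  add := by
    intro Z Z' hZ hZ'
    simp only [koszul, Pi.add_apply, inner_add_left, inner_add_right]
    rw [mvfderiv_fun_add (mdifferentiableAt_inner hY hZ) (mdifferentiableAt_inner hY hZ'),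
      mvfderiv_fun_add (mdifferentiableAt_inner hZ hX) (mdifferentiableAt_inner hZ' hX),
      mlieBracket_add_right hZ hZ', mlieBracket_add_left hZ hZ']
    simp only [inner_add_left, map_add, add_apply]
    ring

/-- The Koszul formula for the Levi-Civita connection. -/
theorem inner_leviCivita
    (hX : MDifferentiableAt I I.tangent (fun y => (X y : TangentBundle I M)) x)
    (hY : MDifferentiableAt I I.tangent (fun y => (Y y : TangentBundle I M)) x)
    (hZ : MDifferentiableAt I I.tangent (fun y => (Z y : TangentBundle I M)) x) :
    inner ℝ (leviCivita I M Y x (X x)) (Z x) = koszul X Y Z x := by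
  set e := stdOrthonormalBasis ℝ (TangentSpace I x) with he
  have h1 : ∀ j, koszul X Y (frame x j) x
      = ∑ i, inner ℝ (e i) (X x) * koszul (frame x i) Y (frame x j) x := by
    intro j
    have ht := koszul_tensorialAt_left (x := x) hY (mdifferentiableAt_frame x j)
    rw [← TensorialAt.mkHom_apply ht hX, ← e.sum_repr' (X x), map_sum]
    refine Finset.sum_congr rfl fun i _ => ?_
    rw [map_smul, TensorialAt.mkHom_apply_eq_extend, smul_eq_mul]
    simp only [e.sum_repr']
    rfl
  have h2 : koszul X Y Z x = ∑ j, inner ℝ (e j) (Z x) * koszul X Y (frame x j) x := by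
    have ht := koszul_tensorialAt_right (x := x) hX hY
    rw [← TensorialAt.mkHom_apply ht hZ, ← e.sum_repr' (Z x), map_sum]
    refine Finset.sum_congr rfl fun i _ => ?_
    rw [map_smul, TensorialAt.mkHom_apply_eq_extend, smul_eq_mul]
    simp only [e.sum_repr']
    rfl
  have h3 : leviCivita I M Y x = leviCivitaFun Y x := rfl
  rw [h2, h3, leviCivitaFun]
  simp only [h1, sum_apply, smul_apply, ContinuousLinearMap.smulRight_apply, innerSL_apply_apply,
    sum_inner, inner_smul_left, RCLike.conj_to_real, Finset.mul_sum]
  rw [Finset.sum_comm]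
  refine Finset.sum_congr rfl fun j _ => Finset.sum_congr rfl fun i _ => ?_
  simp only [frame, extend_apply_self]
  ring

/-- The Levi-Civita connection is torsion-free. -/
theorem leviCivita_sub_leviCivita
    (hX : MDifferentiableAt I I.tangent (fun y => (X y : TangentBundle I M)) x)
    (hY : MDifferentiableAt I I.tangent (fun y => (Y y : TangentBundle I M)) x) :
    leviCivita I M Y x (X x) - leviCivita I M X x (Y x) = mlieBracket I X Y x := by
  refine ext_inner_right ℝ fun z => ?_
  have hz : MDifferentiableAt I I.tangent (fun y => (extend E z y : TangentBundle I M)) x :=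
    (isSmoothAt_extend z).mdifferentiableAt
  have hzx : extend E z x = z := extend_apply_self E z
  rw [inner_sub_left]
  conv_lhs => rw [← hzx]
  rw [inner_leviCivita hX hY hz, inner_leviCivita hY hX hz]
  simp only [koszul, hzx]
  rw [mlieBracket_swap_apply (V := Y) (W := X), mlieBracket_swap_apply (V := X) (W := extend E z),
    mlieBracket_swap_apply (V := Y) (W := extend E z)]
  simp only [inner_neg_left, real_inner_comm]
  ring

/-- The Levi-Civita connection is metric. -/
theorem mvfderiv_inner
    (hY : MDifferentiableAt I I.tangent (fun y => (Y y : TangentBundle I M)) x)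
    (hZ : MDifferentiableAt I I.tangent (fun y => (Z y : TangentBundle I M)) x)
    (v : TangentSpace I x) :
    mvfderiv I (fun y => inner ℝ (Y y) (Z y)) x v
      = inner ℝ (leviCivita I M Y x v) (Z x) + inner ℝ (Y x) (leviCivita I M Z x v) := by
  have hv : MDifferentiableAt I I.tangent (fun y => (extend E v y : TangentBundle I M)) x :=
    (isSmoothAt_extend v).mdifferentiableAt
  have hvx : extend E v x = v := extend_apply_self E v
  conv_rhs => rw [← hvx]
  rw [real_inner_comm _ (Y x), inner_leviCivita hv hY hZ, inner_leviCivita hv hZ hY]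
  simp only [koszul, hvx]
  rw [mlieBracket_swap_apply (V := Z) (W := Y), mlieBracket_swap_apply (V := extend E v) (W := Z),
    mlieBracket_swap_apply (V := extend E v) (W := Y)]
  simp only [inner_neg_left, real_inner_comm]
  ring

/-- A vector field is smooth if its inner products with smooth vector fields are. -/
theorem isSmoothAt_of_inner
    (h : ∀ Z : Π x : M, TangentSpace I x, IsSmoothAt Z x →
      ContMDiffAt I 𝓘(ℝ, ℝ) ∞ (fun y => inner ℝ (W y) (Z y)) x) : IsSmoothAt W x := by
  set t := trivializationAt E (TangentSpace I : M → Type _) x with ht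
  have hx : x ∈ t.baseSet := mem_baseSet_trivializationAt E (TangentSpace I : M → Type _) x
  set o := stdOrthonormalBasis ℝ (TangentSpace I x) with ho
  set ι := Fin (finrank ℝ (TangentSpace I x))
  -- This basis makes the local frame `s` orthonormal at `x`, so its Gram matrix `A` is the identity
  -- there.
  set b : Basis ι ℝ E := o.toBasis.map (t.linearEquivAt ℝ x hx) with hb
  set s : ι → Π y : M, TangentSpace I y := t.localFrame b with hs
  have hsx : ∀ i, s i x = o i := by
    intro i
    simp [hs, hx, Trivialization.basisAt, hb]
  have hsm : ∀ i, IsSmoothAt (s i) x := fun i => contMDiffAt_localFrame_of_mem ∞ t b i hx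
  set c : ι → M → ℝ := fun i y => t.localFrameCoeff I b i y (W y) with hc
  set L : ι → ι → (ι → ℝ) →L[ℝ] (ι → ℝ) := fun i j =>
    (ContinuousLinearMap.proj (R := ℝ) (φ := fun _ : ι => ℝ) i).smulRight (Pi.single j 1) with hL
  set A : M → (ι → ℝ) →L[ℝ] (ι → ℝ) := fun y =>
    ∑ i, ∑ j, (inner ℝ (s i y) (s j y) : ℝ) • L i j with hA
  have hAx : A x = (ContinuousLinearEquiv.refl ℝ (ι → ℝ) : (ι → ℝ) →L[ℝ] (ι → ℝ)) := by
    ext u k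
    simp [hA, hL, hsx, orthonormal_iff_ite.1 o.orthonormal, Pi.single_apply]
  have hAs : ContMDiffAt I 𝓘(ℝ, (ι → ℝ) →L[ℝ] (ι → ℝ)) ∞ A x := by
    refine ContMDiffAt.sum fun i _ => ContMDiffAt.sum fun j _ => ?_
    exact ((hsm i).inner (hsm j)).smul contMDiffAt_const
  have hinv : ContMDiffAt I 𝓘(ℝ, (ι → ℝ) →L[ℝ] (ι → ℝ)) ∞
      (fun y => ContinuousLinearMap.inverse (A y)) x := by
    have h1 : ContDiffAt ℝ ∞ (ContinuousLinearMap.inverse (R := ℝ) (M := ι → ℝ) (M₂ := ι → ℝ))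
        (A x) := by
      rw [hAx]; exact contDiffAt_map_inverse _
    exact h1.contMDiffAt.comp x hAs
  set r : M → ι → ℝ := fun y j => inner ℝ (W y) (s j y) with hr
  have hrs : ContMDiffAt I 𝓘(ℝ, ι → ℝ) ∞ r x :=
    contMDiffAt_pi_space.2 fun j => h (s j) (hsm j)
  -- The coefficients of `W` solve the Gram system `A c = r`. Invertibility is an open condition, so
  -- near `x` they equal `A⁻¹ r`, which is smooth.
  have hcr : ∀ᶠ y in 𝓝 x, (fun i => c i y) = ContinuousLinearMap.inverse (A y) (r y) := by
    have hu : ∀ᶠ y in 𝓝 x, A y ∈ Set.range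
        ((↑) : ((ι → ℝ) ≃L[ℝ] (ι → ℝ)) → ((ι → ℝ) →L[ℝ] (ι → ℝ))) := by
      refine hAs.continuousAt.eventually ?_
      rw [hAx]
      exact ContinuousLinearEquiv.nhds _
    filter_upwards [hu, t.open_baseSet.mem_nhds hx] with y ⟨B, hB⟩ hy
    have h1 : A y (fun i => c i y) = r y := by
      ext j
      have h2 := t.eq_sum_localFrameCoeff_smul (I := I) (s := W) (b := b) hy
      simp only [hr]
      conv_rhs => rw [h2]
      simp [hA, hL, hc, sum_inner, inner_smul_left, Pi.single_apply, mul_comm]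
      rfl
    rw [← h1, ← hB]
    simp
  have hcs : ∀ i, ContMDiffAt I 𝓘(ℝ, ℝ) ∞ (c i) x := by
    have h1 : ContMDiffAt I 𝓘(ℝ, ι → ℝ) ∞ (fun y => fun i => c i y) x :=
      (hinv.clm_apply hrs).congr_of_eventuallyEq hcr
    exact contMDiffAt_pi_space.1 h1
  exact (contMDiffAt_iff_localFrameCoeff (I := I) b hx).2 hcs

/-- The inner products of ∇_X Y with smooth fields are Koszul expressions, hence smooth. -/
theorem IsSmoothAt.leviCivita (hX : IsSmoothAt X x) (hY : IsSmoothAt Y x) :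
    IsSmoothAt (fun y => leviCivita I M Y y (X y)) x := by
  refine isSmoothAt_of_inner fun Z hZ => ?_
  have h1 : ContMDiffAt I 𝓘(ℝ, ℝ) ∞ (fun y => koszul X Y Z y) x := by
    unfold koszul
    have a1 := contMDiffAt_mvfderiv (hY.inner hZ) hX
    have a2 := contMDiffAt_mvfderiv (hZ.inner hX) hY
    have a3 := contMDiffAt_mvfderiv (hX.inner hY) hZ
    have a4 := (hX.mlieBracket hY).inner hZ
    have a5 := (hY.mlieBracket hZ).inner hX
    have a6 := (hZ.mlieBracket hX).inner hY
    exact contMDiffAt_const.mul (((((a1.add a2).sub a3).add a4).sub a5).add a6)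
  refine h1.congr_of_eventuallyEq ?_
  filter_upwards [hX.eventually_mdifferentiableAt, hY.eventually_mdifferentiableAt,
    hZ.eventually_mdifferentiableAt] with y h1 h2 h3
  exact inner_leviCivita h1 h2 h3

end LeviCivita

/-! ### Symmetries and tensoriality of the curvature; Ricci as a trace -/

section Curvature

theorem covariantDerivative_sub (cov : CovariantDerivative I E (TangentSpace I : M → Type _))
    {Y Z : Π x : M, TangentSpace I x} {x : M}
    (hY : MDifferentiableAt I I.tangent (fun y => (Y y : TangentBundle I M)) x)
    (hZ : MDifferentiableAt I I.tangent (fun y => (Z y : TangentBundle I M)) x) :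
    cov (Y - Z) x = cov Y x - cov Z x := by
  have hZ' : MDifferentiableAt I I.tangent
      (fun y => (((-1 : ℝ) • Z) y : TangentBundle I M)) x :=
    mdifferentiableAt_const.smul_section (E := fun x : M => TangentSpace I x) hZ
  have h1 : Y - Z = Y + (-1 : ℝ) • Z := by
    rw [neg_one_smul, sub_eq_add_neg]
  rw [h1, cov.isCovariantDerivativeOnUniv.add hY hZ',
    cov.isCovariantDerivativeOnUniv.smul_const (-1) hZ, neg_one_smul, sub_eq_add_neg]

theorem covariantDerivative_congr (cov : CovariantDerivative I E (TangentSpace I : M → Type _))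
    {Y Z : Π x : M, TangentSpace I x} {x : M}
    (hY : MDifferentiableAt I I.tangent (fun y => (Y y : TangentBundle I M)) x)
    (hZ : MDifferentiableAt I I.tangent (fun y => (Z y : TangentBundle I M)) x)
    (h : ∀ᶠ y in 𝓝 x, Y y = Z y) :
    cov Y x = cov Z x :=
  cov.isCovariantDerivativeOnUniv.congr_of_eventuallyEq hY hZ Filter.univ_mem h

theorem curvature_swap (cov : CovariantDerivative I E (TangentSpace I : M → Type _))
    (X Y Z : Π x : M, TangentSpace I x) (x : M) :
    curvature cov X Y Z x = -curvature cov Y X Z x := by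
  simp only [curvature]
  rw [mlieBracket_swap_apply, map_neg]
  abel

variable [RiemannianBundle (fun x : M => TangentSpace I x)]
  [IsContMDiffRiemannianBundle I ∞ E (fun x : M => TangentSpace I x)]
  {X Y Z W X' Y' Z' : Π x : M, TangentSpace I x} {x : M}

/-- Metricity applied twice. The two mixed terms are together symmetric in X and Y, so they drop out
of the commutator. -/
theorem mvfderiv_mvfderiv_inner (X : Π x : M, TangentSpace I x) (hY : IsSmoothAt Y x)
    (hZ : IsSmoothAt Z x) (hW : IsSmoothAt W x) :
    mvfderiv I (fun y => mvfderiv I (fun y => inner ℝ (Z y) (W y)) y (Y y)) x (X x)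
      = inner ℝ (leviCivita I M (fun y => leviCivita I M Z y (Y y)) x (X x)) (W x)
        + inner ℝ (leviCivita I M Z x (Y x)) (leviCivita I M W x (X x))
        + inner ℝ (leviCivita I M Z x (X x)) (leviCivita I M W x (Y x))
        + inner ℝ (Z x) (leviCivita I M (fun y => leviCivita I M W y (Y y)) x (X x)) := by
  have h1 : (fun y => mvfderiv I (fun y => inner ℝ (Z y) (W y)) y (Y y)) =ᶠ[𝓝 x]
      fun y => inner ℝ (leviCivita I M Z y (Y y)) (W y)
        + inner ℝ (Z y) (leviCivita I M W y (Y y)) := by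
    filter_upwards [hZ.eventually_mdifferentiableAt, hW.eventually_mdifferentiableAt]
      with y hZy hWy
    exact mvfderiv_inner hZy hWy _
  have hYZ := hY.leviCivita hZ
  have hYW := hY.leviCivita hW
  rw [mvfderiv_congr h1, mvfderiv_fun_add ((hYZ.inner hW).mdifferentiableAt (by simp))
    ((hZ.inner hYW).mdifferentiableAt (by simp)), add_apply,
    mvfderiv_inner hYZ.mdifferentiableAt hW.mdifferentiableAt,
    mvfderiv_inner hZ.mdifferentiableAt hYW.mdifferentiableAt]
  ring

/-- The operator XY - YX - [X, Y] annihilates the function g(Z, W). -/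
theorem inner_curvature_skew (hX : IsSmoothAt X x) (hY : IsSmoothAt Y x)
    (hZ : IsSmoothAt Z x) (hW : IsSmoothAt W x) :
    inner ℝ (curvature (leviCivita I M) X Y Z x) (W x)
      = -inner ℝ (curvature (leviCivita I M) X Y W x) (Z x) := by
  have h1 := mvfderiv_mvfderiv_inner X hY hZ hW
  have h2 := mvfderiv_mvfderiv_inner Y hX hZ hW
  have h3 := mvfderiv_mvfderiv_sub (hZ.inner hW) hX hY
  rw [h1, h2, mvfderiv_inner hZ.mdifferentiableAt hW.mdifferentiableAt] at h3
  simp only [curvature, inner_sub_left]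
  simp only [real_inner_comm _ (Z x)] at h3 ⊢
  linarith

/-- The torsion-free identity holds on a neighbourhood, so it can be differentiated; this reduces
the Bianchi identity to Jacobi. -/
theorem leviCivita_leviCivita_sub (hY : IsSmoothAt Y x) (hZ : IsSmoothAt Z x)
    (v : TangentSpace I x) :
    leviCivita I M (fun y => leviCivita I M Z y (Y y)) x v
      - leviCivita I M (fun y => leviCivita I M Y y (Z y)) x v
      = leviCivita I M (mlieBracket I Y Z) x v := by
  rw [← sub_apply, ← covariantDerivative_sub _ (hY.leviCivita hZ).mdifferentiableAt
    (hZ.leviCivita hY).mdifferentiableAt]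
  congr 1
  refine covariantDerivative_congr _ ((hY.leviCivita hZ).sub (hZ.leviCivita hY)).mdifferentiableAt
    (hY.mlieBracket hZ).mdifferentiableAt ?_
  filter_upwards [hY.eventually_mdifferentiableAt, hZ.eventually_mdifferentiableAt] with y h1 h2
  exact leviCivita_sub_leviCivita h1 h2

theorem mlieBracket_jacobi (hX : IsSmoothAt X x) (hY : IsSmoothAt Y x) (hZ : IsSmoothAt Z x) :
    mlieBracket I X (mlieBracket I Y Z) x + mlieBracket I Y (mlieBracket I Z X) x
      + mlieBracket I Z (mlieBracket I X Y) x = 0 := by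
  have : IsManifold I (minSmoothness ℝ 3) M := by
    simp only [minSmoothness_of_isRCLikeNormedField]; infer_instance
  have c2 : ∀ {A : Π x : M, TangentSpace I x}, IsSmoothAt A x →
      ContMDiffAt I I.tangent (minSmoothness ℝ 2) (fun y => (A y : TangentBundle I M)) x := by
    intro A hA
    simp only [minSmoothness_of_isRCLikeNormedField]
    exact ContMDiffAt.of_le hA ENat.LEInfty.out
  have h := leibniz_identity_mlieBracket_apply (c2 hX) (c2 hY) (c2 hZ)
  rw [h, mlieBracket_swap (V := Z) (W := X), mlieBracket_swap_apply (V := Z)]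
  have h2 : mlieBracket I Y (-mlieBracket I X Z) x = -mlieBracket I Y (mlieBracket I X Z) x := by
    have := mlieBracket_const_smul_right (V := Y) (c := (-1 : ℝ)) (hX.mlieBracket hZ).mdifferentiableAt
    simpa using this
  rw [h2]
  abel

/-- The first Bianchi identity. -/
theorem curvature_bianchi (hX : IsSmoothAt X x) (hY : IsSmoothAt Y x) (hZ : IsSmoothAt Z x) :
    curvature (leviCivita I M) X Y Z x + curvature (leviCivita I M) Y Z X x
      + curvature (leviCivita I M) Z X Y x = 0 := by
  have h1 := leviCivita_leviCivita_sub hY hZ (X x)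
  have h2 := leviCivita_leviCivita_sub hZ hX (Y x)
  have h3 := leviCivita_leviCivita_sub hX hY (Z x)
  have t1 := leviCivita_sub_leviCivita hX.mdifferentiableAt (hY.mlieBracket hZ).mdifferentiableAt
  have t2 := leviCivita_sub_leviCivita hY.mdifferentiableAt (hZ.mlieBracket hX).mdifferentiableAt
  have t3 := leviCivita_sub_leviCivita hZ.mdifferentiableAt (hX.mlieBracket hY).mdifferentiableAt
  have hJ := mlieBracket_jacobi hX hY hZ
  rw [← t1, ← t2, ← t3, ← h1, ← h2, ← h3] at hJ
  rw [← hJ]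
  simp only [curvature]
  abel

/-- The pair symmetry of the Riemann curvature tensor. -/
theorem inner_curvature_pair_symm (hX : IsSmoothAt X x) (hY : IsSmoothAt Y x)
    (hZ : IsSmoothAt Z x) (hW : IsSmoothAt W x) :
    inner ℝ (curvature (leviCivita I M) X Y Z x) (W x)
      = inner ℝ (curvature (leviCivita I M) Z W X x) (Y x) := by
  have B : ∀ {A B C D : Π x : M, TangentSpace I x}, IsSmoothAt A x → IsSmoothAt B x →
      IsSmoothAt C x → inner ℝ (curvature (leviCivita I M) A B C x) (D x)
        + inner ℝ (curvature (leviCivita I M) B C A x) (D x)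
        + inner ℝ (curvature (leviCivita I M) C A B x) (D x) = 0 := by
    intro A B C D hA hB hC
    rw [← inner_add_left, ← inner_add_left, curvature_bianchi hA hB hC, inner_zero_left]
  have S : ∀ {A B C D : Π x : M, TangentSpace I x},
      inner ℝ (curvature (leviCivita I M) A B C x) (D x)
        = -inner ℝ (curvature (leviCivita I M) B A C x) (D x) := by
    intro A B C D
    rw [curvature_swap, inner_neg_left]
  -- The classical octahedron argument: the four Bianchi identities combine linearly, modulo the two
  -- skew symmetries.
  have b1 := B (D := W) hX hY hZ
  have b2 := B (D := X) hY hZ hW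
  have b3 := B (D := Y) hZ hW hX
  have b4 := B (D := Z) hW hX hY
  have k1 := inner_curvature_skew hY hZ hX hW
  have k2 := inner_curvature_skew hZ hX hY hW
  have k3 := inner_curvature_skew hX hY hZ hW
  have k4 := inner_curvature_skew hZ hW hY hX
  have k5 := inner_curvature_skew hW hY hZ hX
  have k6 := inner_curvature_skew hW hX hZ hY
  have s1 := S (A := W) (B := Y) (C := X) (D := Z)
  have s2 := S (A := W) (B := X) (C := Z) (D := Y)
  have s3 := S (A := X) (B := Z) (C := W) (D := Y)
  linarith

/-- Pair symmetry followed by skewness moves any chosen slot into the inner product, where only the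
value at `x` enters. -/
theorem curvature_congr (hX : IsSmoothAt X x) (hY : IsSmoothAt Y x) (hZ : IsSmoothAt Z x)
    (hX' : IsSmoothAt X' x) (hY' : IsSmoothAt Y' x) (hZ' : IsSmoothAt Z' x)
    (hXX' : X x = X' x) (hYY' : Y x = Y' x) (hZZ' : Z x = Z' x) :
    curvature (leviCivita I M) X Y Z x = curvature (leviCivita I M) X' Y' Z' x := by
  have first : ∀ {A A' B C : Π x : M, TangentSpace I x}, IsSmoothAt A x → IsSmoothAt A' x →
      IsSmoothAt B x → IsSmoothAt C x → A x = A' x →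
      curvature (leviCivita I M) A B C x = curvature (leviCivita I M) A' B C x := by
    intro A A' B C hA hA' hB hC h
    refine ext_inner_right ℝ fun w => ?_
    have hw : IsSmoothAt (I := I) (extend E w) x := isSmoothAt_extend w
    have hwx : extend E w x = w := extend_apply_self E w
    rw [← hwx, inner_curvature_pair_symm hA hB hC hw, inner_curvature_pair_symm hA' hB hC hw,
      inner_curvature_skew hC hw hA hB, inner_curvature_skew hC hw hA' hB, h]
  rw [first hX hX' hY hZ hXX', curvature_swap, first hY hY' hX' hZ hYY', ← curvature_swap]
  refine ext_inner_right ℝ fun w => ?_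
  have hw : IsSmoothAt (I := I) (extend E w) x := isSmoothAt_extend w
  have hwx : extend E w x = w := extend_apply_self E w
  rw [← hwx, inner_curvature_skew hX' hY' hZ hw, inner_curvature_skew hX' hY' hZ' hw, hZZ']

/-- The right-hand side is visibly linear in `u`, although `extend` is not treated as linear; this
makes `curvatureMap` a linear map. -/
theorem inner_curvature_extend (u v w z : TangentSpace I x) :
    inner ℝ (curvature (leviCivita I M) (extend E u) (extend E v) (extend E w) x) z
      = -inner ℝ (curvature (leviCivita I M) (extend E w) (extend E z) (extend E v) x) u := by
  have h : ∀ u : TangentSpace I x, IsSmoothAt (I := I) (extend E u) x := isSmoothAt_extend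
  have h1 := inner_curvature_pair_symm (h u) (h v) (h w) (h z)
  rw [inner_curvature_skew (h w) (h z) (h u) (h v)] at h1
  simpa only [extend_apply_self] using h1

/-- The linear map `u ↦ R(u, v) w` of the tangent space at `x`. -/
def curvatureMap (x : M) (v w : TangentSpace I x) : TangentSpace I x →ₗ[ℝ] TangentSpace I x where
  toFun u := curvature (leviCivita I M) (extend E u) (extend E v) (extend E w) x
  map_add' u u' := by
    refine ext_inner_right ℝ fun z => ?_
    rw [inner_add_left, inner_curvature_extend, inner_curvature_extend u,
      inner_curvature_extend u', inner_add_right, neg_add]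
  map_smul' c u := by
    refine ext_inner_right ℝ fun z => ?_
    rw [RingHom.id_apply, inner_smul_left, inner_curvature_extend, inner_curvature_extend u,
      inner_smul_right, RCLike.conj_to_real, mul_neg]

theorem sum_repr_eq_trace {V ι : Type*} [AddCommGroup V] [Module ℝ V] [Fintype ι] [DecidableEq ι]
    (b : Basis ι ℝ V) (L : V →ₗ[ℝ] V) : ∑ i, b.repr (L (b i)) i = LinearMap.trace ℝ V L := by
  rw [LinearMap.trace_eq_matrix_trace ℝ b]
  simp [Matrix.trace, LinearMap.toMatrix_apply]

theorem ricci_leviCivita (x : M) (v w : TangentSpace I x) :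
    ricci (leviCivita I M) x v w = LinearMap.trace ℝ _ (curvatureMap x v w) := by
  rw [← sum_repr_eq_trace (finBasis ℝ (TangentSpace I x))]
  rfl

/-- Frees the Ricci trace from the chosen extensions: globally meaningful fields such as U and JU
may be inserted. -/
theorem curvatureMap_apply (hX : IsSmoothAt X x) (hY : IsSmoothAt Y x) (hZ : IsSmoothAt Z x) :
    curvatureMap x (Y x) (Z x) (X x) = curvature (leviCivita I M) X Y Z x :=
  curvature_congr (isSmoothAt_extend _) (isSmoothAt_extend _) (isSmoothAt_extend _) hX hY hZ
    (extend_apply_self E _) (extend_apply_self E _) (extend_apply_self E _)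

end Curvature

/-! ### Parallel unit 1-forms and the curvature of the Weyl connection -/

section ParallelForm

variable [RiemannianBundle (fun x : M => TangentSpace I x)]

theorem inner_sharp (θ : Π x : M, TangentSpace I x →L[ℝ] ℝ) (x : M) (v : TangentSpace I x) :
    inner ℝ (sharp θ x) v = θ x v := by
  simp [sharp]

theorem apply_sharp_self {θ : Π x : M, TangentSpace I x →L[ℝ] ℝ} {x : M} (hθ : ‖θ x‖ = 1) :
    θ x (sharp θ x) = 1 := by
  rw [← inner_sharp, real_inner_self_eq_norm_sq]
  simp [sharp, hθ]

variable [IsContMDiffRiemannianBundle I ∞ E (fun x : M => TangentSpace I x)]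
  {θ : Π x : M, TangentSpace I x →L[ℝ] ℝ} {X Y Z : Π x : M, TangentSpace I x} {x : M}

theorem IsSmoothAt.oneForm_apply (hs : ContMDiff I (I.prod 𝓘(ℝ, E →L[ℝ] ℝ)) ∞
      (fun x => TotalSpace.mk' (E →L[ℝ] ℝ) (E := fun x : M => TangentSpace I x →L[ℝ] ℝ) x (θ x)))
    (hY : IsSmoothAt Y x) : ContMDiffAt I 𝓘(ℝ, ℝ) ∞ (fun y => θ y (Y y)) x := by
  have h : ContMDiffAt I (I.prod 𝓘(ℝ, ℝ)) ∞
      (fun m => TotalSpace.mk' ℝ (E := Bundle.Trivial M ℝ) m (θ m (Y m))) x :=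
    ContMDiffAt.clm_bundle_apply (F₁ := E) (F₂ := ℝ) (E₂ := Bundle.Trivial M ℝ) (hs x) hY
  simp only [contMDiffAt_totalSpace] at h
  exact h.2

theorem isSmoothAt_sharp (hs : ContMDiff I (I.prod 𝓘(ℝ, E →L[ℝ] ℝ)) ∞
      (fun x => TotalSpace.mk' (E →L[ℝ] ℝ) (E := fun x : M => TangentSpace I x →L[ℝ] ℝ) x (θ x))) :
    IsSmoothAt (sharp θ) x := by
  refine isSmoothAt_of_inner fun Z hZ => ?_
  simp only [inner_sharp]
  exact hZ.oneForm_apply hs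

/-- The dual vector field of a smooth parallel 1-form is parallel. -/
theorem leviCivita_sharp (hs : ContMDiff I (I.prod 𝓘(ℝ, E →L[ℝ] ℝ)) ∞
      (fun x => TotalSpace.mk' (E →L[ℝ] ℝ) (E := fun x : M => TangentSpace I x →L[ℝ] ℝ) x (θ x)))
    (hp : IsParallelOneForm θ) (x : M) : leviCivita I M (sharp θ) x = 0 := by
  ext v
  refine ext_inner_right ℝ fun w => ?_
  have hw : MDifferentiableAt I I.tangent (fun y => (extend E w y : TangentBundle I M)) x :=
    (isSmoothAt_extend w).mdifferentiableAt
  have h1 := mvfderiv_inner (isSmoothAt_sharp hs).mdifferentiableAt hw v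
  simp only [inner_sharp] at h1
  rw [hp x v _ hw, extend_apply_self] at h1
  simp only [zero_apply, inner_zero_left]
  linarith

/-- As U is parallel, R(u, U)U = 0 for every u, so the trace is that of the zero map. -/
theorem ricci_sharp_sharp (hs : ContMDiff I (I.prod 𝓘(ℝ, E →L[ℝ] ℝ)) ∞
      (fun x => TotalSpace.mk' (E →L[ℝ] ℝ) (E := fun x : M => TangentSpace I x →L[ℝ] ℝ) x (θ x)))
    (hp : IsParallelOneForm θ) (x : M) :
    ricci (leviCivita I M) x (sharp θ x) (sharp θ x) = 0 := by
  rw [ricci_leviCivita]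
  have h0 : curvatureMap x (sharp θ x) (sharp θ x) = 0 := by
    ext u
    have hu : IsSmoothAt (I := I) (extend E u) x := isSmoothAt_extend u
    have h1 := curvatureMap_apply hu (isSmoothAt_sharp hs) (isSmoothAt_sharp hs)
    rw [extend_apply_self] at h1
    rw [h1]
    have h2 : leviCivita I M (fun y => (0 : TangentSpace I y)) x = 0 :=
      congrFun (leviCivita I M).zero x
    simp [curvature, leviCivita_sharp hs hp, h2]
  rw [h0, map_zero]

/-- The tensor `θ(v) w + θ(w) v - g(v, w) U`; the Weyl connection differs from the Levi-Civita
connection by `-1/2` times this tensor. -/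
def weylTensor (θ : Π x : M, TangentSpace I x →L[ℝ] ℝ) (x : M) (v w : TangentSpace I x) :
    TangentSpace I x :=
  θ x v • w + θ x w • v - (inner ℝ w v : ℝ) • sharp θ x

theorem weylConnection_apply (θ : Π x : M, TangentSpace I x →L[ℝ] ℝ)
    (Y : Π x : M, TangentSpace I x) (x : M) (v : TangentSpace I x) :
    weylConnection θ Y x v = leviCivita I M Y x v - (1 / 2 : ℝ) • weylTensor θ x v (Y x) :=
  rfl

theorem weylTensor_sub_right (x : M) (v w w' : TangentSpace I x) :
    weylTensor θ x v (w - w') = weylTensor θ x v w - weylTensor θ x v w' := by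
  simp only [weylTensor, map_sub, inner_sub_left]
  module

theorem weylTensor_sub_left (x : M) (v v' w : TangentSpace I x) :
    weylTensor θ x (v - v') w = weylTensor θ x v w - weylTensor θ x v' w := by
  simp only [weylTensor, map_sub, inner_sub_right]
  module

theorem weylTensor_smul_right (x : M) (a : ℝ) (v w : TangentSpace I x) :
    weylTensor θ x v (a • w) = a • weylTensor θ x v w := by
  simp only [weylTensor, map_smul, inner_smul_left, RCLike.conj_to_real, smul_eq_mul]
  module

theorem IsSmoothAt.weylTensor (hs : ContMDiff I (I.prod 𝓘(ℝ, E →L[ℝ] ℝ)) ∞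
      (fun x => TotalSpace.mk' (E →L[ℝ] ℝ) (E := fun x : M => TangentSpace I x →L[ℝ] ℝ) x (θ x)))
    (hY : IsSmoothAt Y x) (hZ : IsSmoothAt Z x) :
    IsSmoothAt (fun y => weylTensor θ y (Y y) (Z y)) x :=
  ((IsSmoothAt.smul (hY.oneForm_apply hs) hZ).add (IsSmoothAt.smul (hZ.oneForm_apply hs) hY)).sub
    (IsSmoothAt.smul (hZ.inner hY) (isSmoothAt_sharp hs))

/-- The tensor is built from g, θ and U, all parallel, so it is parallel and only its arguments are
differentiated. -/
theorem leviCivita_weylTensor (hs : ContMDiff I (I.prod 𝓘(ℝ, E →L[ℝ] ℝ)) ∞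
      (fun x => TotalSpace.mk' (E →L[ℝ] ℝ) (E := fun x : M => TangentSpace I x →L[ℝ] ℝ) x (θ x)))
    (hp : IsParallelOneForm θ) (hY : IsSmoothAt Y x) (hZ : IsSmoothAt Z x)
    (v : TangentSpace I x) :
    leviCivita I M (fun y => weylTensor θ y (Y y) (Z y)) x v
      = weylTensor θ x (leviCivita I M Y x v) (Z x)
        + weylTensor θ x (Y x) (leviCivita I M Z x v) := by
  have hU : IsSmoothAt (sharp θ) x := isSmoothAt_sharp hs
  have hθY := hY.oneForm_apply hs
  have hθZ := hZ.oneForm_apply hs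
  have hZY := hZ.inner hY
  have h1 : (fun y => weylTensor θ y (Y y) (Z y))
      = ((fun y => θ y (Y y)) • Z + (fun y => θ y (Z y)) • Y)
        - (fun y => (inner ℝ (Z y) (Y y) : ℝ)) • sharp θ := rfl
  have a1 := IsSmoothAt.smul hθY hZ
  have a2 := IsSmoothAt.smul hθZ hY
  have a3 := IsSmoothAt.smul hZY hU
  have cl := (leviCivita I M).isCovariantDerivativeOnUniv
  rw [h1, covariantDerivative_sub _ (a1.add a2).mdifferentiableAt a3.mdifferentiableAt,
    cl.add a1.mdifferentiableAt a2.mdifferentiableAt,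
    cl.leibniz hZ.mdifferentiableAt (hθY.mdifferentiableAt (by simp)),
    cl.leibniz hY.mdifferentiableAt (hθZ.mdifferentiableAt (by simp)),
    cl.leibniz hU.mdifferentiableAt (hZY.mdifferentiableAt (by simp))]
  simp only [sub_apply, add_apply, smul_apply, ContinuousLinearMap.smulRight_apply,
    hp x v Y hY.mdifferentiableAt, hp x v Z hZ.mdifferentiableAt,
    mvfderiv_inner hZ.mdifferentiableAt hY.mdifferentiableAt, leviCivita_sharp hs hp,
    zero_apply, weylTensor]
  module

/-- With D = ∇ - T/2 and ∇T = 0, the terms T(Y, ∇_X Z) + T(X, ∇_Y Z) cancel by symmetry in X and Y,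
and T(∇_X Y - ∇_Y X, Z) cancels against T([X, Y], Z) since torsion vanishes. Only the quadratic part
survives. -/
theorem curvature_weylConnection (hs : ContMDiff I (I.prod 𝓘(ℝ, E →L[ℝ] ℝ)) ∞
      (fun x => TotalSpace.mk' (E →L[ℝ] ℝ) (E := fun x : M => TangentSpace I x →L[ℝ] ℝ) x (θ x)))
    (hp : IsParallelOneForm θ) (hX : IsSmoothAt X x) (hY : IsSmoothAt Y x) (hZ : IsSmoothAt Z x) :
    curvature (weylConnection θ) X Y Z x = curvature (leviCivita I M) X Y Z x
      + (1 / 4 : ℝ) • (weylTensor θ x (X x) (weylTensor θ x (Y x) (Z x))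
        - weylTensor θ x (Y x) (weylTensor θ x (X x) (Z x))) := by
  have key : ∀ {A B : Π x : M, TangentSpace I x}, IsSmoothAt A x → IsSmoothAt B x →
      weylConnection θ (fun y => weylConnection θ Z y (B y)) x (A x)
        = leviCivita I M (fun y => leviCivita I M Z y (B y)) x (A x)
          - (1 / 2 : ℝ) • (weylTensor θ x (leviCivita I M B x (A x)) (Z x)
            + weylTensor θ x (B x) (leviCivita I M Z x (A x)))
          - (1 / 2 : ℝ) • weylTensor θ x (A x) (leviCivita I M Z x (B x))
          + (1 / 4 : ℝ) • weylTensor θ x (A x) (weylTensor θ x (B x) (Z x)) := by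
    intro A B hA hB
    have hT := IsSmoothAt.weylTensor hs hB hZ
    have h1 : (fun y => weylConnection θ Z y (B y))
        = (fun y => leviCivita I M Z y (B y))
          - (1 / 2 : ℝ) • (fun y => weylTensor θ y (B y) (Z y)) := rfl
    rw [weylConnection_apply, h1, covariantDerivative_sub _ (hB.leviCivita hZ).mdifferentiableAt
      (hT.const_smul _).mdifferentiableAt,
      (leviCivita I M).isCovariantDerivativeOnUniv.smul_const _ hT.mdifferentiableAt]
    simp only [sub_apply, smul_apply, weylConnection_apply, leviCivita_weylTensor hs hp hB hZ,
      weylTensor_sub_right, weylTensor_smul_right]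
    module
  have ht := leviCivita_sub_leviCivita hX.mdifferentiableAt hY.mdifferentiableAt
  simp only [curvature]
  rw [key hX hY, key hY hX, weylConnection_apply, ← ht, weylTensor_sub_left]
  module

/-- The Ricci tensor of the Weyl connection of a parallel 1-form of norm 1. -/
theorem ricci_weylConnection (hs : ContMDiff I (I.prod 𝓘(ℝ, E →L[ℝ] ℝ)) ∞
      (fun x => TotalSpace.mk' (E →L[ℝ] ℝ) (E := fun x : M => TangentSpace I x →L[ℝ] ℝ) x (θ x)))
    (hp : IsParallelOneForm θ) (hθ : ‖θ x‖ = 1) (v w : TangentSpace I x) :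
    ricci (weylConnection θ) x v w = ricci (leviCivita I M) x v w
      - ((finrank ℝ E : ℝ) - 2) / 4 * (inner ℝ v w - θ x v * θ x w) := by
  -- The commutator of the Weyl tensor as a function of `u`: a multiple of the identity plus two
  -- rank-one maps, so its trace can be read off.
  set T : TangentSpace I x →ₗ[ℝ] TangentSpace I x :=
    (θ x v * θ x w - inner ℝ v w : ℝ) • LinearMap.id
      + ((θ x : TangentSpace I x →ₗ[ℝ] ℝ).smulRight
          ((inner ℝ v w : ℝ) • sharp θ x - θ x w • v)
        + (innerSL ℝ w : TangentSpace I x →ₗ[ℝ] ℝ).smulRight (v - θ x v • sharp θ x)) with hT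
  have hTu : ∀ u, T u = weylTensor θ x u (weylTensor θ x v w)
      - weylTensor θ x v (weylTensor θ x u w) := by
    intro u
    have hU := apply_sharp_self hθ
    have hUu := inner_sharp θ x
    simp [hT, weylTensor, hU, hUu, inner_add_left, inner_sub_left, inner_smul_left]
    rw [real_inner_comm v w, real_inner_comm u v]
    module
  have htr : LinearMap.trace ℝ _ T
      = -((finrank ℝ E : ℝ) - 2) * (inner ℝ v w - θ x v * θ x w) := by
    have hfr : finrank ℝ (TangentSpace I x) = finrank ℝ E := rfl
    simp [hT, LinearMap.trace_smulRight, apply_sharp_self hθ, hfr, inner_sub_right,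
      inner_smul_right]
    rw [real_inner_comm (sharp θ x) w, inner_sharp, real_inner_comm v w]
    ring
  rw [ricci_leviCivita]
  have h1 : ricci (weylConnection θ) x v w
      = LinearMap.trace ℝ _ (curvatureMap x v w + (1 / 4 : ℝ) • T) := by
    rw [← sum_repr_eq_trace (finBasis ℝ (TangentSpace I x)), ricci]
    refine Finset.sum_congr rfl fun i _ => ?_
    rw [curvature_weylConnection hs hp (isSmoothAt_extend _) (isSmoothAt_extend _)
      (isSmoothAt_extend _)]
    simp only [extend_apply_self, LinearMap.add_apply, LinearMap.smul_apply, hTu]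
    rfl
  rw [h1, map_add, map_smul, htr, smul_eq_mul]
  ring

end ParallelForm

/-! ### Hermitian structures: ∇J in terms of dω -/

section Hermitian

variable {J : Π x : M, TangentSpace I x →L[ℝ] TangentSpace I x}
  {θ : Π x : M, TangentSpace I x →L[ℝ] ℝ} {X Y Z : Π x : M, TangentSpace I x} {x : M}

theorem IsSmoothAt.complexStructure (hJ : IsComplexStructure J) (hX : IsSmoothAt X x) :
    IsSmoothAt (fun y => J y (X y)) x :=
  ContMDiffAt.clm_bundle_apply (F₁ := E) (F₂ := E) (E₁ := fun x : M => TangentSpace I x)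
    (E₂ := fun x : M => TangentSpace I x) (hJ.contMDiff x) hX

variable [RiemannianBundle (fun x : M => TangentSpace I x)]

theorem inner_complexStructure_left (hJ : IsComplexStructure J)
    (hg : ∀ (x : M) (v w : TangentSpace I x), inner ℝ (J x v) (J x w) = inner ℝ v w)
    (v w : TangentSpace I x) : inner ℝ (J x v) w = -inner ℝ v (J x w) := by
  rw [← hg x v (J x w), hJ.sq, inner_neg_right, neg_neg]

variable [IsContMDiffRiemannianBundle I ∞ E (fun x : M => TangentSpace I x)]

/-- The covariant derivative `v ↦ (∇_v J) Y` of a field of endomorphisms. -/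
def covDerivEnd (J : Π x : M, TangentSpace I x →L[ℝ] TangentSpace I x)
    (Y : Π x : M, TangentSpace I x) (x : M) (v : TangentSpace I x) : TangentSpace I x :=
  leviCivita I M (fun y => J y (Y y)) x v - J x (leviCivita I M Y x v)

/-- The covariant derivative of the skewness of J with respect to a parallel metric. -/
theorem inner_covDerivEnd_skew (hJ : IsComplexStructure J)
    (hg : ∀ (x : M) (v w : TangentSpace I x), inner ℝ (J x v) (J x w) = inner ℝ v w)
    (hY : IsSmoothAt Y x) (hZ : IsSmoothAt Z x) (v : TangentSpace I x) :
    inner ℝ (covDerivEnd J Y x v) (Z x) = -inner ℝ (covDerivEnd J Z x v) (Y x) := by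
  have h1 := mvfderiv_inner (hY.complexStructure hJ).mdifferentiableAt hZ.mdifferentiableAt v
  have h2 := mvfderiv_inner hY.mdifferentiableAt (hZ.complexStructure hJ).mdifferentiableAt v
  have h3 : mvfderiv I (fun y => (inner ℝ (J y (Y y)) (Z y) : ℝ)) x v
      = -mvfderiv I (fun y => (inner ℝ (Y y) (J y (Z y)) : ℝ)) x v := by
    have : (fun y => (inner ℝ (J y (Y y)) (Z y) : ℝ)) = -fun y => (inner ℝ (Y y) (J y (Z y)) : ℝ) :=
      funext fun y => inner_complexStructure_left hJ hg _ _
    rw [this, mvfderiv_neg]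
    rfl
  have f1 := inner_complexStructure_left hJ hg (leviCivita I M Y x v) (Z x)
  have f2 := inner_complexStructure_left hJ hg (leviCivita I M Z x v) (Y x)
  rw [real_inner_comm _ (J x (Y x))] at h1
  rw [real_inner_comm _ (Y x)] at h2
  simp only [covDerivEnd, inner_sub_left]
  linarith

/-- Differentiating J² = -1 shows that ∇J anticommutes with J. -/
theorem covDerivEnd_complexStructure (hJ : IsComplexStructure J) (hY : IsSmoothAt Y x)
    (v : TangentSpace I x) :
    covDerivEnd J (fun y => J y (Y y)) x v = -J x (covDerivEnd J Y x v) := by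
  have h1 : (fun y => J y (J y (Y y))) = (-1 : ℝ) • Y := by
    funext y
    simp [hJ.sq]
  unfold covDerivEnd
  rw [h1, (leviCivita I M).isCovariantDerivativeOnUniv.smul_const _ hY.mdifferentiableAt]
  simp [hJ.sq]
  abel

/-- The exterior derivative of the fundamental form in terms of the covariant derivative of the
complex structure. -/
theorem extDerivTwoForm_fundamentalForm (hJ : IsComplexStructure J)
    (hg : ∀ (x : M) (v w : TangentSpace I x), inner ℝ (J x v) (J x w) = inner ℝ v w)
    (hX : IsSmoothAt X x) (hY : IsSmoothAt Y x) (hZ : IsSmoothAt Z x) :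
    extDerivTwoForm (fundamentalForm J) X Y Z x
      = -(inner ℝ (covDerivEnd J Y x (X x)) (Z x) + inner ℝ (covDerivEnd J Z x (Y x)) (X x)
        + inner ℝ (covDerivEnd J X x (Z x)) (Y x)) := by
  have key : ∀ {A B : Π x : M, TangentSpace I x} (v : TangentSpace I x), IsSmoothAt A x →
      IsSmoothAt B x → mvfderiv I (fun y => (inner ℝ (A y) (J y (B y)) : ℝ)) x v
        = inner ℝ (leviCivita I M A x v) (J x (B x)) - inner ℝ (leviCivita I M B x v) (J x (A x))
          - inner ℝ (covDerivEnd J A x v) (B x) := by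
    intro A B v hA hB
    have h1 := inner_covDerivEnd_skew hJ hg hA hB v
    have h2 := inner_complexStructure_left hJ hg (leviCivita I M B x v) (A x)
    rw [mvfderiv_inner hA.mdifferentiableAt (hB.complexStructure hJ).mdifferentiableAt, h1,
      covDerivEnd, inner_sub_left, h2, real_inner_comm _ (A x)]
    ring
  simp only [extDerivTwoForm, fundamentalForm]
  rw [key _ hY hZ, key _ hZ hX, key _ hX hY,
    ← leviCivita_sub_leviCivita hX.mdifferentiableAt hY.mdifferentiableAt,
    ← leviCivita_sub_leviCivita hY.mdifferentiableAt hZ.mdifferentiableAt,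
    ← leviCivita_sub_leviCivita hZ.mdifferentiableAt hX.mdifferentiableAt]
  simp only [inner_sub_left]
  ring

/-- The vanishing of the Nijenhuis tensor in terms of the covariant derivative of the complex
structure. -/
theorem covDerivEnd_integrable (hJ : IsComplexStructure J) (hX : IsSmoothAt X x)
    (hY : IsSmoothAt Y x) :
    covDerivEnd J Y x (J x (X x)) - covDerivEnd J X x (J x (Y x))
      + J x (covDerivEnd J X x (Y x)) - J x (covDerivEnd J Y x (X x)) = 0 := by
  have hJX := hX.complexStructure hJ
  have hJY := hY.complexStructure hJ
  have h := hJ.integrable x X Y hX.mdifferentiableAt hY.mdifferentiableAt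
  rw [← leviCivita_sub_leviCivita hX.mdifferentiableAt hY.mdifferentiableAt,
    ← leviCivita_sub_leviCivita hJX.mdifferentiableAt hY.mdifferentiableAt,
    ← leviCivita_sub_leviCivita hX.mdifferentiableAt hJY.mdifferentiableAt,
    ← leviCivita_sub_leviCivita hJX.mdifferentiableAt hJY.mdifferentiableAt] at h
  rw [← h]
  simp only [covDerivEnd, map_sub, hJ.sq]
  abel

/-- Both values of dω are cyclic sums of ∇J. Pairing the vanishing Nijenhuis tensor of (Y, Z) with
JX, together with skewness and anticommutation, cancels everything but the (∇_X J)Y terms. Thus dω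
alone determines ∇J. -/
theorem two_mul_inner_covDerivEnd (hJ : IsComplexStructure J)
    (hg : ∀ (x : M) (v w : TangentSpace I x), inner ℝ (J x v) (J x w) = inner ℝ v w)
    (hX : IsSmoothAt X x) (hY : IsSmoothAt Y x) (hZ : IsSmoothAt Z x) :
    2 * inner ℝ (covDerivEnd J Y x (X x)) (Z x)
      = extDerivTwoForm (fundamentalForm J) X (fun y => J y (Y y)) (fun y => J y (Z y)) x
        - extDerivTwoForm (fundamentalForm J) X Y Z x := by
  have hJY := hY.complexStructure hJ
  have hJZ := hZ.complexStructure hJ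
  have hN := congrArg (fun u => inner ℝ u (J x (X x))) (covDerivEnd_integrable hJ hY hZ)
  rw [extDerivTwoForm_fundamentalForm hJ hg hX hY hZ,
    extDerivTwoForm_fundamentalForm hJ hg hX hJY hJZ]
  have s1 := inner_covDerivEnd_skew hJ hg hX hJY (J x (Z x))
  have s2 := inner_covDerivEnd_skew hJ hg hX hY (Z x)
  simp only [inner_sub_left, inner_add_left, inner_zero_left, hg] at hN
  have f1 := inner_complexStructure_left hJ hg (covDerivEnd J Z x (J x (Y x))) (X x)
  have f2 := inner_complexStructure_left hJ hg (covDerivEnd J Y x (J x (Z x))) (X x)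
  simp only [covDerivEnd_complexStructure hJ hY, covDerivEnd_complexStructure hJ hZ,
    inner_neg_left, hg] at s1 ⊢
  linarith

end Hermitian

/-! ### The Reeb field JU and its Ricci curvature -/

section Vaisman

variable [RiemannianBundle (fun x : M => TangentSpace I x)]
  [IsContMDiffRiemannianBundle I ∞ E (fun x : M => TangentSpace I x)]
  {J : Π x : M, TangentSpace I x →L[ℝ] TangentSpace I x}
  {θ : Π x : M, TangentSpace I x →L[ℝ] ℝ}

/-- The covariant derivative of the Reeb field `JU` of a Vaisman structure. -/
theorem IsVaisman.leviCivita_reeb (hV : IsVaisman J θ) (hθ : ∀ x, ‖θ x‖ = 1) (x : M)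
    (v : TangentSpace I x) :
    leviCivita I M (fun y => J y (sharp θ y)) x v
      = -((1 / 2 : ℝ) • (J x v - θ x v • J x (sharp θ x)
        + (inner ℝ v (J x (sharp θ x)) : ℝ) • sharp θ x)) := by
  have hJ := hV.isComplexStructure
  have hg := hV.hermitian
  refine ext_inner_right ℝ fun z => ?_
  have hv : IsSmoothAt (I := I) (extend E v) x := isSmoothAt_extend v
  have hz : IsSmoothAt (I := I) (extend E z) x := isSmoothAt_extend z
  have hU : IsSmoothAt (sharp θ) x := isSmoothAt_sharp hV.contMDiff_lee
  -- Since ∇U = 0, the derivative of JU is (∇J)U, which the formula for ∇J expresses through dω =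
  -- θ∧ω.
  have h := two_mul_inner_covDerivEnd hJ hg hv hU hz
  rw [hV.extDeriv_eq x _ _ _ hv.mdifferentiableAt hU.mdifferentiableAt hz.mdifferentiableAt,
    hV.extDeriv_eq x _ _ _ hv.mdifferentiableAt (hU.complexStructure hJ).mdifferentiableAt
      (hz.complexStructure hJ).mdifferentiableAt, covDerivEnd,
    leviCivita_sharp hV.contMDiff_lee hV.parallel] at h
  have hθ' : ∀ w, θ x w = inner ℝ (sharp θ x) w := fun w => (inner_sharp θ x w).symm
  have hUU : inner ℝ (sharp θ x) (sharp θ x) = (1 : ℝ) := by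
    rw [inner_sharp, apply_sharp_self (hθ x)]
  have hUV : inner ℝ (sharp θ x) (J x (sharp θ x)) = (0 : ℝ) := by
    have := inner_complexStructure_left hJ hg (sharp θ x) (sharp θ x)
    rw [real_inner_comm] at this
    linarith
  simp only [fundamentalForm, extend_apply_self, zero_apply, map_zero, sub_zero, hJ.sq,
    inner_neg_right, hg, hθ', hUU, hUV] at h
  simp only [inner_neg_left, inner_smul_left, inner_add_left, inner_sub_left,
    RCLike.conj_to_real, hθ']
  have e1 := inner_complexStructure_left hJ hg (sharp θ x) z
  rw [e1, real_inner_comm z (J x v)]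
  rw [e1, real_inner_comm (sharp θ x) v] at h
  linarith

/-- The Ricci curvature of a Vaisman manifold in the direction of the Reeb field. -/
theorem IsVaisman.ricci_reeb (hV : IsVaisman J θ) (hθ : ∀ x, ‖θ x‖ = 1) (x : M) :
    ricci (leviCivita I M) x (J x (sharp θ x)) (J x (sharp θ x)) = ((finrank ℝ E : ℝ) - 2) / 4 := by
  have hJ := hV.isComplexStructure
  have hg := hV.hermitian
  set V : Π x : M, TangentSpace I x := fun y => J y (sharp θ y) with hVdef
  have hUU : ∀ y, inner ℝ (sharp θ y) (sharp θ y) = (1 : ℝ) := by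
    intro y
    rw [inner_sharp, apply_sharp_self (hθ y)]
  have hUV : ∀ y, inner ℝ (sharp θ y) (J y (sharp θ y)) = (0 : ℝ) := by
    intro y
    have := inner_complexStructure_left hJ hg (sharp θ y) (sharp θ y)
    rw [real_inner_comm] at this
    linarith
  have hVs : IsSmoothAt V x := (isSmoothAt_sharp hV.contMDiff_lee).complexStructure hJ
  have hD := fun y v => hV.leviCivita_reeb hθ y v
  have hθ' : ∀ y w, θ y w = inner ℝ (sharp θ y) w := fun y w => (inner_sharp θ y w).symm
  -- ∇V is skew, that is, V is a Killing field.
  have hskew : ∀ y v, inner ℝ (leviCivita I M V y v) v = (0 : ℝ) := by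
    intro y v
    have h0 : inner ℝ (J y v) v = (0 : ℝ) := by
      have := inner_complexStructure_left hJ hg v v
      rw [real_inner_comm] at this ⊢
      linarith
    rw [hD]
    simp only [inner_neg_left, inner_smul_left, inner_add_left, inner_sub_left,
      RCLike.conj_to_real, hθ', h0]
    rw [real_inner_comm v (J y (sharp θ y))]
    ring
  have hskew' : ∀ v w, inner ℝ (leviCivita I M V x v) w
      = -(inner ℝ (leviCivita I M V x w) v : ℝ) := by
    intro v w
    have h1 := hskew x (v + w)
    rw [map_add, inner_add_left, inner_add_right, inner_add_right, hskew, hskew] at h1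
    linarith
  have hVV : ∀ y, leviCivita I M V y (V y) = 0 := by
    intro y
    rw [hD]
    simp only [hVdef, hJ.sq, hg, hUU, hθ', hUV]
    module
  -- ∇V is, up to sign, half of J on the orthogonal complement of U and V, and vanishes on U and V.
  have hnorm : ∀ v, inner ℝ (leviCivita I M V x v) (leviCivita I M V x v)
      = (1 / 4 : ℝ) * (inner ℝ v v - inner ℝ v (sharp θ x) * inner ℝ (sharp θ x) v
        - inner ℝ v (V x) * inner ℝ (V x) v) := by
    intro v
    have e1 : inner ℝ (J x v) (sharp θ x) = -(inner ℝ v (V x) : ℝ) :=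
      inner_complexStructure_left hJ hg _ _
    have e2 : inner ℝ (V x) (sharp θ x) = (0 : ℝ) := by rw [real_inner_comm]; exact hUV x
    rw [hD]
    simp only [inner_neg_left, inner_neg_right, inner_smul_left, inner_smul_right, inner_add_left,
      inner_sub_left, inner_add_right, inner_sub_right, RCLike.conj_to_real, hθ', hg, hUU, hUV]
    change _ = (1 / 4 : ℝ) * (inner ℝ v v - inner ℝ v (sharp θ x) * inner ℝ (sharp θ x) v
        - inner ℝ v (J x (sharp θ x)) * inner ℝ (J x (sharp θ x)) v)
    change inner ℝ (J x v) (sharp θ x) = -(inner ℝ v (J x (sharp θ x)) : ℝ) at e1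
    change inner ℝ (J x (sharp θ x)) (sharp θ x) = (0 : ℝ) at e2
    rw [real_inner_comm (J x v) (sharp θ x), e1, e2, real_inner_comm v (sharp θ x),
      real_inner_comm v (J x (sharp θ x))]
    ring
  -- For a Killing field with ∇_V V = 0: differentiating g(∇_X V, X) = 0 along V and using skewness
  -- on [X, V] makes the terms in ∇_V X cancel.
  have hR : ∀ v, inner ℝ v (curvatureMap x (V x) (V x) v)
      = (inner ℝ (leviCivita I M V x v) (leviCivita I M V x v) : ℝ) := by
    intro v
    set X : Π x : M, TangentSpace I x := extend E v with hX'
    have hX : IsSmoothAt X x := isSmoothAt_extend v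
    have hXx : X x = v := extend_apply_self E v
    have h1 := curvatureMap_apply hX hVs hVs
    rw [hXx] at h1
    have h2 : leviCivita I M (fun y => (0 : TangentSpace I y)) x = 0 :=
      congrFun (leviCivita I M).zero x
    have hφX : IsSmoothAt (fun y => leviCivita I M V y (X y)) x := hX.leviCivita hVs
    have h3 := mvfderiv_inner hφX.mdifferentiableAt hX.mdifferentiableAt (V x)
    simp only [hskew] at h3
    rw [mvfderiv_const, zero_apply, hXx] at h3
    have h4 := leviCivita_sub_leviCivita hX.mdifferentiableAt hVs.mdifferentiableAt
    rw [hXx] at h4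
    rw [h1, real_inner_comm]
    simp only [curvature, hVV, h2, zero_apply, inner_sub_left, inner_zero_left]
    rw [hskew', ← h4, inner_sub_right]
    linarith
  change ricci (leviCivita I M) x (V x) (V x) = _
  set o := stdOrthonormalBasis ℝ (TangentSpace I x)
  rw [ricci_leviCivita, LinearMap.trace_eq_sum_inner _ o]
  simp only [hR, hnorm]
  -- The three sums are d, |U|² = 1 and |V|² = 1, which gives (d-2)/4.
  rw [← Finset.mul_sum, Finset.sum_sub_distrib, Finset.sum_sub_distrib]
  have t1 : ∑ i, (inner ℝ (o i) (o i) : ℝ) = finrank ℝ E := by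
    simp
    rfl
  have t2 : ∑ i, (inner ℝ (o i) (sharp θ x) * inner ℝ (sharp θ x) (o i) : ℝ) = 1 := by
    simp only [mul_comm (inner ℝ (o _) (sharp θ x) : ℝ)]
    rw [o.sum_inner_mul_inner, hUU]
  have t3 : ∑ i, (inner ℝ (o i) (V x) * inner ℝ (V x) (o i) : ℝ) = 1 := by
    simp only [mul_comm (inner ℝ (o _) (V x) : ℝ)]
    rw [o.sum_inner_mul_inner]
    simp only [hVdef, hg, hUU]
  rw [t1, t2, t3]
  ring

end Vaisman

/-! ### Both conditions are equivalent to Weyl Ricci-flatness -/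

section Main

variable [RiemannianBundle (fun x : M => TangentSpace I x)]
  [IsContMDiffRiemannianBundle I ∞ E (fun x : M => TangentSpace I x)]
  {J : Π x : M, TangentSpace I x →L[ℝ] TangentSpace I x}
  {θ : Π x : M, TangentSpace I x →L[ℝ] ℝ}
  {N : Type*} [TopologicalSpace N] [ChartedSpace H N]

theorem IsUniversalCover.mfderiv_surjective {p : N → M} (hp : IsUniversalCover I p) (y : N)
    (v : TangentSpace I (p y)) : ∃ w : TangentSpace I y, mfderiv I I p y w = v :=
  ⟨((hp.isLocalDiffeomorph y).mfderivToContinuousLinearEquiv (by simp)).symm v,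
    ((hp.isLocalDiffeomorph y).mfderivToContinuousLinearEquiv (by simp)).apply_symm_apply v⟩

/-- A Vaisman structure with Lee form of norm 1 is Einstein-Weyl if and only if the Weyl connection
is Ricci-flat. -/
theorem IsVaisman.isEinsteinWeyl_iff (hV : IsVaisman J θ) (hθ : ∀ x, ‖θ x‖ = 1)
    {p : N → M} (hp : IsUniversalCover I p) (f : N → ℝ) :
    IsEinsteinWeyl p f θ ↔
      ∀ (x : M) (v w : TangentSpace I x), ricci (weylConnection θ) x v w = 0 := by
  constructor
  · rintro ⟨l, hl⟩ x v w
    obtain ⟨y, rfl⟩ := hp.surjective x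
    -- Evaluation on a lift of U: Ric^D(U, U) = 0, whereas g̃ takes the positive value exp(-f)
    -- there.
    have hl0 : l = 0 := by
      obtain ⟨u, hu⟩ := hp.mfderiv_surjective y (sharp θ (p y))
      have h := hl y u u
      rw [coverMetric, hu, ricci_weylConnection hV.contMDiff_lee hV.parallel (hθ _),
        ricci_sharp_sharp hV.contMDiff_lee hV.parallel, inner_sharp,
        apply_sharp_self (hθ _)] at h
      simpa [(Real.exp_pos _).ne'] using h
    obtain ⟨u, hu⟩ := hp.mfderiv_surjective y v
    obtain ⟨u', hu'⟩ := hp.mfderiv_surjective y w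
    rw [← hu, ← hu', hl y u u', hl0, zero_mul]
  · intro h
    exact ⟨0, fun y v w => by rw [h, zero_mul]⟩

/-- A Vaisman structure with Lee form of norm 1 is quasi-Einstein if and only if the Weyl connection
is Ricci-flat. -/
theorem IsVaisman.isQuasiEinstein_iff (hV : IsVaisman J θ) (hθ : ∀ x, ‖θ x‖ = 1) :
    IsQuasiEinstein θ ↔
      ∀ (x : M) (v w : TangentSpace I x), ricci (weylConnection θ) x v w = 0 := by
  have hW := fun (x : M) (v w : TangentSpace I x) =>
    ricci_weylConnection hV.contMDiff_lee hV.parallel (hθ x) v w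
  constructor
  · rintro ⟨l, β, -, -, h⟩ x v w
    have hU := h x (sharp θ x) (sharp θ x)
    have hJU := h x (J x (sharp θ x)) (J x (sharp θ x))
    have hUV : θ x (J x (sharp θ x)) = 0 := by
      have := inner_complexStructure_left hV.isComplexStructure hV.hermitian (sharp θ x) (sharp θ x)
      rw [real_inner_comm, inner_sharp] at this
      linarith
    rw [ricci_sharp_sharp hV.contMDiff_lee hV.parallel, inner_sharp, apply_sharp_self (hθ x)] at hU
    rw [hV.ricci_reeb hθ, hV.hermitian, inner_sharp, apply_sharp_self (hθ x), hUV] at hJU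
    -- Evaluation on U gives λ + β = 0, and evaluation on JU, where θ vanishes, gives λ = (d-2)/4.
    have hβ : β x = -l x := by linarith
    have hl : l x = ((finrank ℝ E : ℝ) - 2) / 4 := by linarith
    rw [hW, h, hβ, hl]
    ring
  · intro h
    refine ⟨fun _ => ((finrank ℝ E : ℝ) - 2) / 4, fun _ => -(((finrank ℝ E : ℝ) - 2) / 4),
      contMDiff_const, contMDiff_const, fun x v w => ?_⟩
    have h1 := h x v w
    rw [hW] at h1
    linarith

end Main

end VaismanGeometry

end

open VaismanGeometry in
theorem mainTheorem5 (n : ℕ) (hn : 1 ≤ n)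
    {M : Type*} [TopologicalSpace M] [T2Space M] [CompactSpace M] [ConnectedSpace M]
    [ChartedSpace (EuclideanSpace ℝ (Fin (2 * n + 2))) M] [IsManifold (𝓡 (2 * n + 2)) ∞ M]
    [RiemannianBundle (fun x : M => TangentSpace (𝓡 (2 * n + 2)) x)]
    [IsContMDiffRiemannianBundle (𝓡 (2 * n + 2)) ∞ (EuclideanSpace ℝ (Fin (2 * n + 2)))
      (fun x : M => TangentSpace (𝓡 (2 * n + 2)) x)]
    (J : Π x : M, TangentSpace (𝓡 (2 * n + 2)) x →L[ℝ] TangentSpace (𝓡 (2 * n + 2)) x)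
    (θ : Π x : M, TangentSpace (𝓡 (2 * n + 2)) x →L[ℝ] ℝ)
    (hV : IsVaisman J θ) (hθ : ∀ x : M, ‖θ x‖ = 1)
    {N : Type*} [TopologicalSpace N] [ChartedSpace (EuclideanSpace ℝ (Fin (2 * n + 2))) N]
    [IsManifold (𝓡 (2 * n + 2)) ∞ N]
    (p : N → M) (hp : IsUniversalCover (𝓡 (2 * n + 2)) p)
    (f : N → ℝ) (hf : IsPrimitive p θ f) :
    IsEinsteinWeyl p f θ ↔ IsQuasiEinstein θ := by
  rw [hV.isEinsteinWeyl_iff hθ hp f, hV.isQuasiEinstein_iff hθ]
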